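/- Let $M$ be a smooth (Hausdorff, second countable) manifold of dimension $m$, let $\pi:TM\to M$ be its tangent bundle, and write $(x^i,v^i)$ for the chart of $TM$ induced by a chart $(x^i)$ of $M$. Let $B=\sum_j dx^j\otimes\frac{\partial}{\partial v^j}$ be the mirror map (the canonical vertical endomorphism of $T(TM)$, i.e. $d\pi$ followed by the vertical lift), let $(i_B\alpha)(w_1,\dots,w_p)=\sum_{k}\alpha(w_1,\dots,Bw_k,\dots,w_p)$, and let $d_B=i_B\circ d-d\circ i_B:\Omega^p(TM)\to\Omega^{p+1}(TM)$. For a constant $c\in\mathbb R$ put $D=c\,d+d_B$ and $$H^p_D(TM)=\frac{\{\eta\in\Omega^p(TM): D\eta=0\}}{\{D\tau:\tau\in\Omega^{p-1}(TM)\}},\qquad \Omega^{-1}=0.$$ The complete lift of a $p$-form $\omega=\sum_{i_1<\dots<i_p}o_{i_1\cdots i_p}\,dx^{i_1}\wedge\cdots\wedge dx^{i_p}$ on $M$ is the $p$-form on $TM$ given locally by $$\widetilde\omega=\sum_{i_1<\dots<i_p}\Big(\sum_j v^j\frac{\partial o_{i_1\cdots i_p}}{\partial x^j}\,dx^{i_1}\wedge\cdots\wedge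 dx^{i_p}+o_{i_1\cdots i_p}\sum_{k=1}^p dx^{i_1}\wedge\cdots\wedge dv^{i_k}\wedge\cdots\wedge dx^{i_p}\Big).$$ Suppose $c\neq0$. Then, for every $p\ge0$, the maps $$H^p(M)\to H^p_D(TM),\quad [\omega]\mapsto[\widetilde\omega],\qquad\text{and}\qquad H^p(M)\to H^p_D(TM),\quad[\omega]\mapsto[\pi^*\omega],$$ are well-defined linear maps on the de Rham cohomology of $M$ (in particular $\widetilde\omega$ and $\pi^*\omega$ are smooth $D$-closed forms whenever $\omega$ is closed). Moreover, for every $p\ge1$ and every closed $\omega\in\Omega^p(M)$, $[\widetilde\omega]=0$ in $H^p_D(TM)$ if and only if $[\pi^*\omega]=0$ in $H^p_D(TM)$. -/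

import Mathlib

open scoped Manifold ContDiff Topology

noncomputable section

open Set Bundle

section Forms

variable {E : Type*} [NormedAddCommGroup E] [NormedSpace ℝ E]
  {F : Type*} [NormedAddCommGroup F] [NormedSpace ℝ F]
  {H : Type*} [TopologicalSpace H]

/-- For linear maps `A`, `B` and an alternating form `f`, the alternating form
`(w₁, …, wₚ) ↦ ∑ᵢ f (A w₁, …, B wᵢ, …, A wₚ)`, see `insertSum_apply`; it is linear in `f`. -/
def insertSum {p : ℕ} (A B : E →L[ℝ] F) : (F [⋀^Fin p]→L[ℝ] ℝ) →L[ℝ] (E [⋀^Fin p]→L[ℝ] ℝ) :=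
  (ContinuousAlternatingMap.fderivCompContinuousLinearMapCLM ℝ A).flip B

theorem insertSum_apply {p : ℕ} (A B : E →L[ℝ] F) (f : F [⋀^Fin p]→L[ℝ] ℝ) (w : Fin p → E) :
    insertSum A B f w = ∑ i, f (Function.update (fun j => A (w j)) i (B (w i))) := by
  simp only [insertSum, ContinuousLinearMap.flip_apply,
    ContinuousAlternatingMap.fderivCompContinuousLinearMapCLM_apply,
    ContinuousAlternatingMap.fderivCompContinuousLinearMap_apply]
  refine Finset.sum_congr rfl fun i _ => congrArg f (funext fun j => ?_)
  rcases eq_or_ne j i with rfl | h <;> simp [*]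

variable (I : ModelWithCorners ℝ E H) (M : Type*) [TopologicalSpace M] [ChartedSpace H M]

/-- Exterior `p`-forms on `M`, not necessarily smooth: a choice of an alternating `p`-linear form
on every tangent space. -/
def RawForm (p : ℕ) : Type _ := ∀ x : M, TangentSpace I x [⋀^Fin p]→L[ℝ] ℝ

instance (p : ℕ) : AddCommGroup (RawForm I M p) :=
  inferInstanceAs (AddCommGroup (∀ x : M, TangentSpace I x [⋀^Fin p]→L[ℝ] ℝ))

instance (p : ℕ) : Module ℝ (RawForm I M p) :=
  inferInstanceAs (Module ℝ (∀ x : M, TangentSpace I x [⋀^Fin p]→L[ℝ] ℝ))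

variable {M}

/-- The form `α` read in the chart at `x₀`: its pull-back under the inverse of the chart. -/
def chartRep {p : ℕ} (α : RawForm I M p) (x₀ : M) (y : E) : E [⋀^Fin p]→L[ℝ] ℝ :=
  (α ((extChartAt I x₀).symm y)).compContinuousLinearMap
    (mfderivWithin 𝓘(ℝ, E) I (extChartAt I x₀).symm (range I) y)

/-- The exterior derivative, computed at every point `x` in the chart at `x`. -/
def rawExtDeriv {p : ℕ} (α : RawForm I M p) : RawForm I M (p + 1) := fun x =>
  (extDerivWithin (chartRep I α x) (range I) (extChartAt I x x)).compContinuousLinearMap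
    (mfderiv I 𝓘(ℝ, E) (extChartAt I x) x)

variable (M) in
/-- The space `Ω^p(M)` of smooth `p`-forms: those with smooth coefficients in the charts. -/
def SmoothForm (p : ℕ) : Submodule ℝ (RawForm I M p) where
  carrier := {α | ∀ x₀ : M, ContDiffOn ℝ ∞ (chartRep I α x₀) (extChartAt I x₀).target}
  zero_mem' _ := contDiffOn_const (c := 0)
  add_mem' hα hη x₀ := (hα x₀).add (hη x₀)
  smul_mem' c _ hα x₀ := (hα x₀).const_smul c

variable {I}

theorem chartRep_change [IsManifold I ∞ M] {p : ℕ} (α : RawForm I M p) (x₀ x₁ : M) {y : E}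
    (hy : y ∈ ((extChartAt I x₀).symm ≫ extChartAt I x₁).source) :
    chartRep I α x₀ y =
      (chartRep I α x₁ (extChartAt I x₁ ((extChartAt I x₀).symm y))).compContinuousLinearMap
        (fderivWithin ℝ (extChartAt I x₁ ∘ (extChartAt I x₀).symm) (range I) y) := by
  have hyt : y ∈ (extChartAt I x₀).target := by
    have := hy; simp only [PartialEquiv.trans_source, PartialEquiv.symm_source] at this
    exact this.1
  have hys : (extChartAt I x₀).symm y ∈ (extChartAt I x₁).source := by
    have := hy; simp only [PartialEquiv.trans_source, PartialEquiv.symm_source] at this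
    exact this.2
  have hyr : y ∈ range I := extChartAt_target_subset_range x₀ hyt
  have U : UniqueMDiffWithinAt 𝓘(ℝ, E) (range I) y := I.uniqueMDiffOn y hyr
  have e : (extChartAt I x₁).symm (extChartAt I x₁ ((extChartAt I x₀).symm y)) =
      (extChartAt I x₀).symm y := (extChartAt I x₁).left_inv hys
  have h1 : fderivWithin ℝ (extChartAt I x₁ ∘ (extChartAt I x₀).symm) (range I) y =
      (mfderiv I 𝓘(ℝ, E) (extChartAt I x₁) ((extChartAt I x₀).symm y)).comp
        (mfderivWithin 𝓘(ℝ, E) I (extChartAt I x₀).symm (range I) y) := by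
    rw [← mfderivWithin_eq_fderivWithin]
    refine mfderiv_comp_mfderivWithin y ?_ (mdifferentiableWithinAt_extChartAt_symm hyt) U
    exact mdifferentiableAt_extChartAt (by rwa [← extChartAt_source I])
  have h2 := mfderivWithin_extChartAt_symm_comp_mfderiv_extChartAt' (I := I) hys
  have key : ∀ (r r' : M) (_ : r = r') (w : Fin p → E), α r w = α r' w := by
    rintro r _ rfl w; rfl
  ext w
  rw [h1]
  refine ((key _ _ e _).trans (congrArg (α _) (funext fun i => ?_))).symm
  exact congrArg (fun L : TangentSpace I _ →L[ℝ] TangentSpace I _ =>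
    L (mfderivWithin 𝓘(ℝ, E) I (extChartAt I x₀).symm (range I) y (w i))) h2

/-- The exterior derivative may be computed in any chart. -/
theorem chartRep_rawExtDeriv [IsManifold I ∞ M] {p : ℕ} {α : RawForm I M p}
    (hα : α ∈ SmoothForm I M p) (x₀ : M) {y : E} (hy : y ∈ (extChartAt I x₀).target) :
    chartRep I (rawExtDeriv I α) x₀ y = extDerivWithin (chartRep I α x₀) (range I) y := by
  set q := (extChartAt I x₀).symm y with hq
  have hqs : q ∈ (extChartAt I x₀).source := (extChartAt I x₀).map_target hy
  have hyr : y ∈ range I := extChartAt_target_subset_range x₀ hy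
  have hys : y ∈ ((extChartAt I x₀).symm ≫ extChartAt I q).source := by
    simp only [PartialEquiv.trans_source, PartialEquiv.symm_source]
    exact ⟨hy, mem_extChartAt_source q⟩
  have hτ : ContDiffWithinAt ℝ ∞ (extChartAt I q ∘ (extChartAt I x₀).symm) (range I) y :=
    contDiffWithinAt_ext_coord_change q x₀ hys
  have U : UniqueMDiffWithinAt 𝓘(ℝ, E) (range I) y := I.uniqueMDiffOn y hyr
  have h1 : fderivWithin ℝ (extChartAt I q ∘ (extChartAt I x₀).symm) (range I) y =
      (mfderiv I 𝓘(ℝ, E) (extChartAt I q) q).comp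
        (mfderivWithin 𝓘(ℝ, E) I (extChartAt I x₀).symm (range I) y) := by
    rw [← mfderivWithin_eq_fderivWithin]
    refine mfderiv_comp_mfderivWithin y ?_ (mdifferentiableWithinAt_extChartAt_symm hy) U
    exact mdifferentiableAt_extChartAt (mem_chart_source H q)
  have hnear : chartRep I α x₀ =ᶠ[𝓝[range I] y] fun z =>
      (chartRep I α q ((extChartAt I q ∘ (extChartAt I x₀).symm) z)).compContinuousLinearMap
        (fderivWithin ℝ (extChartAt I q ∘ (extChartAt I x₀).symm) (range I) z) := by
    filter_upwards [I.extendCoordChange_source_mem_nhdsWithin hys] with z hz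
    exact chartRep_change α x₀ q hz
  rw [hnear.extDerivWithin_eq (hnear.self_of_nhdsWithin hyr),
    extDerivWithin_pullback (r := ∞) (t := range I) _ hτ
      (by rw [minSmoothness_of_isRCLikeNormedField]; exact ENat.LEInfty.out) I.uniqueDiffOn
      (I.range_subset_closure_interior hyr) hyr, h1]
  · rfl
  · exact fun z _ => by simp [extChartAt]
  · have hq' : extChartAt I q q ∈ (extChartAt I q).target := mem_extChartAt_target q
    exact (((hα q) _ hq').differentiableWithinAt (by simp)).mono_of_mem_nhdsWithin
      (extChartAt_target_mem_nhdsWithin q)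

theorem rawExtDeriv_mem [IsManifold I ∞ M] {p : ℕ} {α : RawForm I M p}
    (hα : α ∈ SmoothForm I M p) : rawExtDeriv I α ∈ SmoothForm I M (p + 1) := by
  intro x₀
  refine ContDiffOn.congr (f := extDerivWithin (chartRep I α x₀) (range I)) ?_
    fun y hy => chartRep_rawExtDeriv hα x₀ hy
  intro y hy
  have h : ContDiffWithinAt ℝ ∞ (chartRep I α x₀) (range I) y :=
    (hα x₀ y hy).mono_of_mem_nhdsWithin (extChartAt_target_mem_nhdsWithin_of_mem hy)
  have h' := h.fderivWithin_right (m := ∞) I.uniqueDiffOn (by simp)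
    (extChartAt_target_subset_range x₀ hy)
  exact (((ContinuousAlternatingMap.alternatizeUncurryFinCLM ℝ E ℝ).contDiff.contDiffAt
    ).comp_contDiffWithinAt y h').mono (extChartAt_target_subset_range x₀)

theorem chartRep_differentiableWithinAt {p : ℕ} {α : RawForm I M p}
    (hα : α ∈ SmoothForm I M p) (x : M) :
    DifferentiableWithinAt ℝ (chartRep I α x) (range I) (extChartAt I x x) :=
  ((hα x _ (mem_extChartAt_target x)).differentiableWithinAt (by simp)).mono_of_mem_nhdsWithin
    (extChartAt_target_mem_nhdsWithin x)

variable (I M) in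
/-- The exterior derivative `d : Ω^p(M) → Ω^{p+1}(M)`. -/
def extDer [IsManifold I ∞ M] (p : ℕ) : SmoothForm I M p →ₗ[ℝ] SmoothForm I M (p + 1) where
  toFun α := ⟨rawExtDeriv I α.1, rawExtDeriv_mem α.2⟩
  map_add' α β := by
    refine Subtype.ext (funext fun x => ?_)
    have h := extDerivWithin_add (I.uniqueDiffOn _ (mem_range_self (chartAt H x x)))
      (chartRep_differentiableWithinAt α.2 x) (chartRep_differentiableWithinAt β.2 x)
    exact congrArg (fun f : E [⋀^Fin (p + 1)]→L[ℝ] ℝ => f.compContinuousLinearMap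
      (mfderiv I 𝓘(ℝ, E) (extChartAt I x) x)) h
  map_smul' c α := by
    refine Subtype.ext (funext fun x => ?_)
    have h := extDerivWithin_smul c (chartRep I α.1 x)
      (I.uniqueDiffOn _ (mem_range_self (chartAt H x x)))
    exact congrArg (fun f : E [⋀^Fin (p + 1)]→L[ℝ] ℝ => f.compContinuousLinearMap
      (mfderiv I 𝓘(ℝ, E) (extChartAt I x) x)) h

/-- The insertion `(i_K α)(w₁, …, wₚ) = ∑ᵢ α(w₁, …, K wᵢ, …, wₚ)` of a field `K` of endomorphisms
of the tangent spaces, i.e. of a vector valued one-form. It vanishes on functions. -/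
def rawInsert {p : ℕ} (K : ∀ x : M, TangentSpace I x →L[ℝ] TangentSpace I x)
    (α : RawForm I M p) : RawForm I M p := fun x =>
  insertSum (E := E) (F := E) (ContinuousLinearMap.id ℝ E) (K x) (α x)

end Forms

section Complexes

variable (Ω : ℕ → Type*) [∀ p, AddCommGroup (Ω p)] [∀ p, Module ℝ (Ω p)]
  (δ : ∀ p, Ω p →ₗ[ℝ] Ω (p + 1))

variable {Ω}

/-- The image of `δ` in degree `p`; it is zero in degree `0`. -/
def boundaries : ∀ p, Submodule ℝ (Ω p)
  | 0 => ⊥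
  | p + 1 => LinearMap.range (δ p)

/-- The degree `p` cohomology `{α ∈ Ω p : δ α = 0} / {δ τ : τ ∈ Ω (p - 1)}`. -/
abbrev Cohomology (p : ℕ) : Type _ :=
  LinearMap.ker (δ p) ⧸ (boundaries δ p).comap (LinearMap.ker (δ p)).subtype

/-- The class of a cocycle. -/
abbrev cohomologyClass (p : ℕ) : LinearMap.ker (δ p) →ₗ[ℝ] Cohomology δ p :=
  ((boundaries δ p).comap (LinearMap.ker (δ p)).subtype).mkQ

end Complexes

section Tangent

variable {E : Type*} [NormedAddCommGroup E] [NormedSpace ℝ E]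
  {H : Type*} [TopologicalSpace H]
  (I : ModelWithCorners ℝ E H) {M : Type*} [TopologicalSpace M] [ChartedSpace H M]

section
variable [IsManifold I 1 M]

/-- The vertical lift `T_{π u} M → T_u TM`, the derivative at `u` of the inclusion of the fibre. -/
def verticalLift (u : TangentBundle I M) :
    TangentSpace I u.proj →L[ℝ] TangentSpace I.tangent u :=
  mfderiv 𝓘(ℝ, E) I.tangent (fun w : E => (⟨u.proj, w⟩ : TangentBundle I M)) u.2

/-- The derivative of the projection `π : TM → M` at `u`. -/
def projDeriv (u : TangentBundle I M) :
    TangentSpace I.tangent u →L[ℝ] TangentSpace I u.proj :=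
  mfderiv I.tangent I (fun w : TangentBundle I M => w.proj) u

/-- The mirror map `B : TTM → TTM`, the composition of `dπ` with the vertical lift. In the chart
`(xⁱ, vⁱ)` of `TM` induced by a chart of `M` it is `∑ⱼ dxʲ ⊗ ∂/∂vʲ`, see `mirrorMap_chart`. -/
def mirrorMap (u : TangentBundle I M) :
    TangentSpace I.tangent u →L[ℝ] TangentSpace I.tangent u :=
  (verticalLift I u).comp (projDeriv I u)

/-- The pull-back `π^* α` of a form on `M` to `TM`. -/
def rawPullback {p : ℕ} (α : RawForm I M p) : RawForm I.tangent (TangentBundle I M) p := fun u =>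
  (α u.proj).compContinuousLinearMap (projDeriv I u)

/-- The complete lift to `TM` of a form `α` on `M`. Let `(xⁱ, vⁱ)` be the chart of `TM` induced by
the chart `(xⁱ)` of `M` at `π u`. If `α = ∑ a_{i₁…iₚ} dx^{i₁} ∧ ⋯ ∧ dx^{iₚ}` there, then its complete
lift is
`∑ (∑ⱼ vʲ ∂a_{i₁…iₚ}/∂xʲ dx^{i₁} ∧ ⋯ ∧ dx^{iₚ} + a_{i₁…iₚ} ∑ₖ dx^{i₁} ∧ ⋯ ∧ dv^{iₖ} ∧ ⋯ ∧ dx^{iₚ})`.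
In particular, the complete lift of a function `f` is the function `df` on `TM`. In the code `z` is
the coordinate vector `(x, v)` of `u`, and `(dx, dv)` are the two projections of `E × E`. -/
def rawCompleteLift {p : ℕ} (α : RawForm I M p) :
    RawForm I.tangent (TangentBundle I M) p := fun u =>
  let a : E → E [⋀^Fin p]→L[ℝ] ℝ := chartRep I α u.proj
  let z : E × E := extChartAt I.tangent u u
  ((fderivWithin ℝ a (range I) z.1 z.2).compContinuousLinearMap (ContinuousLinearMap.fst ℝ E E)
    + insertSum (ContinuousLinearMap.fst ℝ E E) (ContinuousLinearMap.snd ℝ E E) (a z.1)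
    ).compContinuousLinearMap (mfderiv I.tangent 𝓘(ℝ, E × E) (extChartAt I.tangent u) u)

end

variable [IsManifold I ∞ M]

/-- The inverse of a chart of `TM` induced by a chart of `M`. -/
theorem extChartAt_tangent_symm (u : TangentBundle I M) {y : E × E}
    (hy : y.1 ∈ (extChartAt I u.proj).target) :
    (extChartAt I.tangent u).symm y = (⟨(extChartAt I u.proj).symm y.1,
      (mfderivWithin 𝓘(ℝ, E) I (extChartAt I u.proj).symm (range I) y.1 : E →L[ℝ] E) y.2⟩ :
        TangentBundle I M) := by
  have hx : (extChartAt I u.proj).symm y.1 ∈ (chartAt H u.proj).source := by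
    rw [← extChartAt_source I]; exact (extChartAt I u.proj).map_target hy
  have h := TangentBundle.symmL_trivializationAt (𝕜 := ℝ) (I := I) hx
  rw [(extChartAt I u.proj).right_inv hy] at h
  refine Eq.trans ?_ (congrArg (fun L : E →L[ℝ] E =>
    (⟨(extChartAt I u.proj).symm y.1, L y.2⟩ : TangentBundle I M)) h)
  have h' := (trivializationAt E (TangentSpace I) u.proj).mk_symm hx y.2
  rw [← Trivialization.symmL_apply (R := ℝ) (trivializationAt E (TangentSpace I) u.proj) hx] at h'
  refine Eq.trans ?_ h'.symm
  rfl

theorem mdifferentiable_fibreIncl (x : M) : MDifferentiable 𝓘(ℝ, E) I.tangent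
    (fun w : E => (⟨x, w⟩ : TangentBundle I M)) := by
  intro w
  refine ContMDiffAt.mdifferentiableAt (n := ∞) ?_ (by simp)
  rw [Bundle.contMDiffAt_totalSpace]
  refine ⟨contMDiffAt_const, ?_⟩
  let T : E →L[ℝ] E := (trivializationAt E (TangentSpace I) x).continuousLinearMapAt ℝ x
  have h : (fun w : E => ((trivializationAt E (TangentSpace I) x)
      (⟨x, w⟩ : TangentBundle I M)).2) = T := by
    funext w
    exact ((trivializationAt E (TangentSpace I) x).continuousLinearMapAt_apply_of_mem
      ℝ (mem_chart_source H x) w).symm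
  exact (congrArg (fun g : E → E => ContMDiffAt 𝓘(ℝ, E) 𝓘(ℝ, E) ∞ g w) h).mpr
    T.contDiff.contMDiff.contMDiffAt

theorem target_of_tangent (u : TangentBundle I M) {y : E × E}
    (hy : y ∈ (extChartAt I.tangent u).target) : y.1 ∈ (extChartAt I u.proj).target := by
  rw [extChartAt_target] at hy ⊢
  refine ⟨?_, ?_⟩
  · exact ((TangentBundle.mem_chart_target_iff (I := I) _ u).1 hy.1)
  · obtain ⟨z, hz⟩ := hy.2
    exact ⟨z.1, congrArg Prod.fst hz⟩

open ContinuousLinearMap in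
/-- In the charts of `TM` the mirror map is the constant endomorphism `(a, b) ↦ (0, a)`. -/
theorem mirrorMap_chart (u : TangentBundle I M) {y : E × E}
    (hy : y ∈ (extChartAt I.tangent u).target) :
    (mirrorMap I ((extChartAt I.tangent u).symm y)).comp
      (mfderivWithin 𝓘(ℝ, E × E) I.tangent (extChartAt I.tangent u).symm (range I.tangent) y) =
    (mfderivWithin 𝓘(ℝ, E × E) I.tangent (extChartAt I.tangent u).symm (range I.tangent) y).comp
      ((inr ℝ E E).comp (fst ℝ E E)) := by
  have hy1 := target_of_tangent I u hy
  have hyr : y ∈ range I.tangent := extChartAt_target_subset_range u hy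
  have U : UniqueMDiffWithinAt 𝓘(ℝ, E × E) (range I.tangent) y := I.tangent.uniqueMDiffOn y hyr
  have hΦ := mdifferentiableWithinAt_extChartAt_symm hy
  let A : E →L[ℝ] E := mfderivWithin 𝓘(ℝ, E) I (extChartAt I u.proj).symm (range I) y.1
  let L : E × E →L[ℝ] E × E :=
    mfderivWithin 𝓘(ℝ, E × E) I.tangent (extChartAt I.tangent u).symm (range I.tangent) y
  let P : E × E →L[ℝ] E := projDeriv I ((extChartAt I.tangent u).symm y)
  let V : E →L[ℝ] E × E := verticalLift I ((extChartAt I.tangent u).symm y)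
  have e1 : P.comp L = A.comp (fst ℝ E E) := by
    have hπ : MDifferentiableAt I.tangent I (fun w : TangentBundle I M => w.proj)
        ((extChartAt I.tangent u).symm y) :=
      ((Bundle.contMDiff_proj (n := ∞) (TangentSpace I : M → Type _)).mdifferentiable
        (by simp)) _
    have h1 := mfderiv_comp_mfderivWithin y hπ hΦ U
    have h2 := mfderivWithin_comp (I := 𝓘(ℝ, E × E)) (I' := 𝓘(ℝ, E)) (I'' := I)
      (f := Prod.fst) (s := range I.tangent) (u := range I) y
      (mdifferentiableWithinAt_extChartAt_symm (I := I) hy1)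
      (fst ℝ E E).mdifferentiableWithinAt
      (by rintro _ ⟨z, rfl⟩; exact ⟨z.1, rfl⟩) U
    have h3 := (fst ℝ E E).mfderivWithin_eq U
    refine h1.symm.trans (Eq.trans ?_ (h2.trans (congrArg A.comp h3)))
    rfl
  have e2 : V.comp A = L.comp (inr ℝ E E) := by
    have hs := extChartAt_tangent_symm I u hy1
    have hcurve : ∀ w : E, (extChartAt I.tangent u).symm (y.1, w) =
        (⟨(extChartAt I u.proj).symm y.1, A w⟩ : TangentBundle I M) := fun w =>
      extChartAt_tangent_symm I u (y := (y.1, w)) hy1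
    have h1 := mfderiv_comp (I := 𝓘(ℝ, E)) (I' := 𝓘(ℝ, E)) (I'' := I.tangent) (f := A) y.2
      (mdifferentiable_fibreIncl I ((extChartAt I u.proj).symm y.1) (A y.2))
      A.mdifferentiableAt
    have h2 := mfderivWithin_comp (I := 𝓘(ℝ, E)) (I' := 𝓘(ℝ, E × E)) (I'' := I.tangent)
      (f := fun w : E => (y.1, w)) (s := univ) (u := range I.tangent) y.2 hΦ
      ((contDiff_prodMk_right y.1).contMDiff.mdifferentiable (n := ∞) (by simp)
        y.2).mdifferentiableWithinAt
      (by
        intro w _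
        obtain ⟨z, hz⟩ := hyr
        have hz1 : (I.tangent z).1 = y.1 := congrArg Prod.fst hz
        exact ⟨(z.1, w), Prod.ext hz1 rfl⟩)
      (uniqueMDiffWithinAt_univ _)
    rw [mfderivWithin_univ, mfderivWithin_univ] at h2
    have h3 : mfderiv 𝓘(ℝ, E) 𝓘(ℝ, E × E) (fun w : E => (y.1, w)) y.2 = inr ℝ E E := by
      rw [mfderiv_eq_fderiv]
      exact (hasFDerivAt_prodMk_right y.1 y.2).fderiv
    have h4 : mfderiv 𝓘(ℝ, E) 𝓘(ℝ, E) A y.2 = A := A.mfderiv_eq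
    have hV : V = mfderiv 𝓘(ℝ, E) I.tangent (fun w : E =>
        (⟨(extChartAt I u.proj).symm y.1, w⟩ : TangentBundle I M)) (A y.2) := by
      have : ∀ (q q' : TangentBundle I M) (_ : q = q'), (verticalLift I q : E →L[ℝ] E × E) =
          verticalLift I q' := by rintro q _ rfl; rfl
      exact this _ _ hs
    have h5 : ((extChartAt I.tangent u).symm ∘ fun w : E => (y.1, w)) =
      (fun w : E => (⟨(extChartAt I u.proj).symm y.1, w⟩ : TangentBundle I M)) ∘ A :=
      funext hcurve
    have h6 : ∀ (f g : E → TangentBundle I M) (_ : f = g),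
        (mfderiv 𝓘(ℝ, E) I.tangent f y.2 : E →L[ℝ] E × E) =
          mfderiv 𝓘(ℝ, E) I.tangent g y.2 := by rintro f _ rfl; rfl
    have h7 : (mfderiv 𝓘(ℝ, E) I.tangent ((extChartAt I.tangent u).symm ∘ fun w : E => (y.1, w))
        y.2 : E →L[ℝ] E × E) =
        L.comp (mfderiv 𝓘(ℝ, E) 𝓘(ℝ, E × E) (fun w : E => (y.1, w)) y.2) := h2
    refine Eq.trans ?_ (h7.trans (congrArg (fun X : E →L[ℝ] E × E => L.comp X) h3))
    let G : E →L[ℝ] E × E := mfderiv 𝓘(ℝ, E) I.tangent (fun w : E =>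
      (⟨(extChartAt I u.proj).symm y.1, w⟩ : TangentBundle I M)) (A y.2)
    have a1 : V.comp A = G.comp A := congrArg (fun X : E →L[ℝ] E × E => X.comp A) hV
    have a2 : G.comp (mfderiv 𝓘(ℝ, E) 𝓘(ℝ, E) A y.2 : E →L[ℝ] E) = G.comp A :=
      congrArg (fun X : E →L[ℝ] E => G.comp X) h4
    exact a1.trans (a2.symm.trans (h1.symm.trans (h6 _ _ h5.symm)))
  have h : (V.comp P).comp L = L.comp ((inr ℝ E E).comp (fst ℝ E E)) := by
    rw [comp_assoc, e1, ← comp_assoc, e2, comp_assoc]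
  exact h

/-- The form `i_B α` read in a chart of `TM` is `i_K` of the chart representation of `α`, with `K`
the constant endomorphism `(a, b) ↦ (0, a)`. -/
theorem chartRep_rawInsert_mirrorMap {p : ℕ} (α : RawForm I.tangent (TangentBundle I M) p)
    (u : TangentBundle I M) {y : E × E} (hy : y ∈ (extChartAt I.tangent u).target) :
    chartRep I.tangent (rawInsert (mirrorMap I) α) u y =
      insertSum (ContinuousLinearMap.id ℝ (E × E))
        ((ContinuousLinearMap.inr ℝ E E).comp (ContinuousLinearMap.fst ℝ E E))
        (chartRep I.tangent α u y) := by
  ext w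
  have h := mirrorMap_chart I u hy
  let q : TangentBundle I M := (extChartAt I.tangent u).symm y
  let f : (E × E) [⋀^Fin p]→L[ℝ] ℝ := α q
  let K : E × E →L[ℝ] E × E :=
    (ContinuousLinearMap.inr ℝ E E).comp (ContinuousLinearMap.fst ℝ E E)
  let L : E × E →L[ℝ] E × E :=
    mfderivWithin 𝓘(ℝ, E × E) I.tangent (extChartAt I.tangent u).symm (range I.tangent) y
  let B : E × E →L[ℝ] E × E := mirrorMap I q
  have h' : B.comp L = L.comp K := h
  have h1 : chartRep I.tangent (rawInsert (mirrorMap I) α) u y w =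
    insertSum (ContinuousLinearMap.id ℝ (E × E)) B f (fun i => L (w i)) := rfl
  have h2 : chartRep I.tangent α u y = f.compContinuousLinearMap L := rfl
  rw [h1, h2, insertSum_apply, insertSum_apply]
  refine Finset.sum_congr rfl fun i _ => congrArg f (funext fun j => ?_)
  have h3 : B (L (w i)) = L (K (w i)) := congrArg (fun X : E × E →L[ℝ] E × E => X (w i)) h'
  rcases eq_or_ne j i with rfl | hj
  · simp only [Function.update_self]
    exact h3
  · simp [hj]

theorem rawInsert_mirrorMap_mem {p : ℕ} {α : RawForm I.tangent (TangentBundle I M) p}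
    (hα : α ∈ SmoothForm I.tangent (TangentBundle I M) p) :
    rawInsert (mirrorMap I) α ∈ SmoothForm I.tangent (TangentBundle I M) p := fun u =>
  ((insertSum (ContinuousLinearMap.id ℝ (E × E)) ((ContinuousLinearMap.inr ℝ E E).comp
    (ContinuousLinearMap.fst ℝ E E))).contDiff.comp_contDiffOn (hα u)).congr
      fun _ hy => chartRep_rawInsert_mirrorMap I α u hy

variable (M)

/-- The insertion `i_B : Ω^p(TM) → Ω^p(TM)` of the mirror map. -/
def mirrorInsert (p : ℕ) : SmoothForm I.tangent (TangentBundle I M) p →ₗ[ℝ]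
    SmoothForm I.tangent (TangentBundle I M) p where
  toFun α := ⟨rawInsert (mirrorMap I) α.1, rawInsert_mirrorMap_mem I α.2⟩
  map_add' α β := Subtype.ext (funext fun u => map_add (insertSum (E := E × E) (F := E × E)
    (ContinuousLinearMap.id ℝ (E × E)) (mirrorMap I u)) (α.1 u) (β.1 u))
  map_smul' c α := Subtype.ext (funext fun u => map_smul (insertSum (E := E × E) (F := E × E)
    (ContinuousLinearMap.id ℝ (E × E)) (mirrorMap I u)) c (α.1 u))

/-- The derivation `d_B = [i_B, d] = i_B ∘ d - d ∘ i_B : Ω^p(TM) → Ω^{p+1}(TM)`. -/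
def mirrorDer (p : ℕ) : SmoothForm I.tangent (TangentBundle I M) p →ₗ[ℝ]
    SmoothForm I.tangent (TangentBundle I M) (p + 1) :=
  (mirrorInsert I M (p + 1)).comp (extDer I.tangent (TangentBundle I M) p) -
    (extDer I.tangent (TangentBundle I M) p).comp (mirrorInsert I M p)

/-- The operator `D = c d + d_B : Ω^p(TM) → Ω^{p+1}(TM)`. -/
def mirrorD (c : ℝ) (p : ℕ) : SmoothForm I.tangent (TangentBundle I M) p →ₗ[ℝ]
    SmoothForm I.tangent (TangentBundle I M) (p + 1) :=
  c • extDer I.tangent (TangentBundle I M) p + mirrorDer I M p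

end Tangent

end

noncomputable section

open Set Bundle

/-! For a closed form `ω` of degree `p ≥ 1`, let `θ` be its contraction with the tautological vector
field, the `(p - 1)`-form on `TM` with value `ω(u, dπ w₂, …, dπ wₚ)` at `u`. Cartan's formula, with
`dω = 0`, gives `dθ = ω̃` (`extDerivWithin_curryLeft_snd`, `extDer_tautContraction_val`). The mirror
map takes vertical values, so `i_B` kills every horizontal form, in particular `θ` and `π^*ω`. It
also turns each `dv` back into `dx`, whence `i_B ω̃ = p π^*ω`.

Therefore `Dθ = c ω̃ + p π^*ω` (`mirrorD_tautContraction`), so `[ω̃] = -(p/c) [π^*ω]` in `H_D`. The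
same rules give `D π^*α = c π^* dα`, so `π^*` descends to cohomology, exact forms going to `D`-exact
ones because `c` is invertible. The lift on cohomology can then be taken to be `-(p/c) π^*`. It is
well defined and linear at once, and vanishes on the same classes as `π^*` when `p ≥ 1`. In degree
`0` both the factor and the complete lift of a locally constant function are zero. -/

theorem LinearMap.smul_apply_eq_zero_iff {V W : Type*} [AddCommGroup V] [Module ℝ V]
    [AddCommGroup W] [Module ℝ W] {r : ℝ} (hr : r ≠ 0) (f : V →ₗ[ℝ] W) (v : V) :
    (r • f) v = 0 ↔ f v = 0 := by
  rw [LinearMap.smul_apply, smul_eq_zero, or_iff_right hr]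

/-! ### Pointwise algebra of the insertion, and Cartan's formula on `E × E`. -/

section LinearAlgebra

variable {E : Type*} [NormedAddCommGroup E] [NormedSpace ℝ E]

open ContinuousLinearMap

/-- Forms pulled back along `fst` are killed by the insertion of `(a, b) ↦ (0, a)`. -/
theorem insertSum_inr_fst_compContinuousLinearMap {p : ℕ} (g : E [⋀^Fin p]→L[ℝ] ℝ) :
    insertSum (ContinuousLinearMap.id ℝ (E × E)) ((inr ℝ E E).comp (fst ℝ E E))
      (g.compContinuousLinearMap (fst ℝ E E)) = 0 := by
  ext w
  rw [insertSum_apply]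
  refine Finset.sum_eq_zero fun i _ => ?_
  rw [ContinuousAlternatingMap.compContinuousLinearMap_apply]
  exact g.map_coord_zero i (by simp)

/-- Replacing `wᵢ` by the vertical vector `(0, wᵢ.1)` leaves a zero in slot `i` unless that is the
slot read by `snd`. So each `i` contributes one diagonal term, equal to `a` on the first components,
and there are `p` of them. -/
theorem insertSum_inr_fst_insertSum_fst_snd {p : ℕ} (a : E [⋀^Fin p]→L[ℝ] ℝ) :
    insertSum (ContinuousLinearMap.id ℝ (E × E)) ((inr ℝ E E).comp (fst ℝ E E))
      (insertSum (fst ℝ E E) (snd ℝ E E) a) = (p : ℝ) • a.compContinuousLinearMap (fst ℝ E E) := by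
  ext w
  rw [insertSum_apply]
  have h : ∀ i : Fin p, insertSum (fst ℝ E E) (snd ℝ E E) a
      (Function.update (fun j => ContinuousLinearMap.id ℝ (E × E) (w j)) i
        (((inr ℝ E E).comp (fst ℝ E E)) (w i))) = a fun j => (w j).1 := by
    intro i
    rw [insertSum_apply, Finset.sum_eq_single i]
    · refine congrArg a (funext fun j => ?_)
      rcases eq_or_ne j i with rfl | hj <;> simp [*]
    · intro k _ hk
      exact a.map_coord_zero i (by simp [Function.update_of_ne hk.symm])
    · simp
  rw [Finset.sum_congr rfl fun i _ => h i]
  rw [Finset.sum_const, Finset.card_univ, Fintype.card_fin, ← Nat.cast_smul_eq_nsmul ℝ]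
  rfl

/-- Cartan's formula for the contraction of a form on `E` with the tautological vector
field of `E × E` over `E`. -/
theorem extDerivWithin_curryLeft_snd {p : ℕ} {a : E → E [⋀^Fin (p + 1)]→L[ℝ] ℝ} {s : Set E}
    {S : Set (E × E)} {z : E × E} (ha : DifferentiableWithinAt ℝ a s z.1)
    (hS : UniqueDiffWithinAt ℝ S z) (hSs : MapsTo Prod.fst S s) :
    extDerivWithin (fun y : E × E =>
        ((a y.1).curryLeft y.2).compContinuousLinearMap (fst ℝ E E)) S z =
      (fderivWithin ℝ a s z.1 z.2).compContinuousLinearMap (fst ℝ E E)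
        + insertSum (fst ℝ E E) (snd ℝ E E) (a z.1)
        - ((extDerivWithin a s z.1).curryLeft z.2).compContinuousLinearMap (fst ℝ E E) := by
  let C := (ContinuousAlternatingMap.curryLeftLI (𝕜 := ℝ) (E := E) (F := ℝ)
    (n := p)).toContinuousLinearMap
  let P : (E [⋀^Fin p]→L[ℝ] ℝ) →L[ℝ] ((E × E) [⋀^Fin p]→L[ℝ] ℝ) :=
    ContinuousAlternatingMap.compContinuousLinearMapCLM (fst ℝ E E)
  have h0 : HasFDerivWithinAt (fun y : E × E => a y.1)
      ((fderivWithin ℝ a s z.1).comp (fst ℝ E E)) S z :=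
    ha.hasFDerivWithinAt.comp z (hasFDerivAt_fst.hasFDerivWithinAt) hSs
  have h1 := HasFDerivAt.comp_hasFDerivWithinAt (F := E [⋀^Fin (p + 1)]→L[ℝ] ℝ)
    (G := E →L[ℝ] E [⋀^Fin p]→L[ℝ] ℝ) (g := C) (g' := C) (f := fun y : E × E => a y.1) z
    C.hasFDerivAt h0
  -- Leibniz rule for the pairing of `a y.1` with `y.2`: one term differentiates the coefficients,
  -- the other replaces `z.2` by the second component of the direction.
  have h2 := P.hasFDerivAt.comp_hasFDerivWithinAt z
    (h1.clm_apply (hasFDerivAt_snd (𝕜 := ℝ) (p := z)).hasFDerivWithinAt)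
  have h3 := h2.fderivWithin hS
  rw [extDerivWithin]
  refine (congrArg ContinuousAlternatingMap.alternatizeUncurryFin h3).trans ?_
  have hC : ∀ f v w, C f v w = f (Matrix.vecCons v w) := fun _ _ _ => rfl
  have hP : ∀ f w, P f w = f (fun i => (w i).1) := fun _ _ => rfl
  ext w
  -- The summand of index `0` differentiates along `z.2`. In the others the index is shifted by one,
  -- which flips the sign and gives minus the alternation of the first Leibniz term.
  have hd : extDerivWithin a s z.1 (Matrix.vecCons z.2 fun i => (w i).1) =
      fderivWithin ℝ a s z.1 z.2 (fun i => (w i).1) - ∑ i : Fin (p + 1), (-1 : ℤ) ^ (i : ℕ) •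
        fderivWithin ℝ a s z.1 (w i).1
          (Matrix.vecCons z.2 (fun j => (i.removeNth w j).1)) := by
    rw [extDerivWithin, ContinuousAlternatingMap.alternatizeUncurryFin_apply, Fin.sum_univ_succ,
      sub_eq_add_neg, ← Finset.sum_neg_distrib]
    congr 1
    · simp [Matrix.vecCons]
    · refine Finset.sum_congr rfl fun i _ => ?_
      have : i.succ.removeNth (Matrix.vecCons z.2 fun i => (w i).1) =
          (Matrix.vecCons z.2 (fun j => (i.removeNth w j).1) : Fin (p + 1) → E) := by
        funext j
        refine Fin.cases ?_ (fun j => ?_) j <;> simp [Fin.removeNth]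
      rw [this]
      simp [pow_succ]
  -- Moving the vertical component from the front back to slot `i` costs `(-1)^i`, which cancels the
  -- sign of the alternation. The second Leibniz term thus becomes `insertSum`.
  have hi : ∀ i : Fin (p + 1), (-1 : ℤ) ^ (i : ℕ) •
      a z.1 (Matrix.vecCons (w i).2 (fun j => (i.removeNth w j).1)) =
      a z.1 (Function.update (fun j => (w j).1) i (w i).2) := by
    intro i
    rw [← ContinuousAlternatingMap.neg_one_pow_smul_map_insertNth, smul_smul, ← pow_add,
      Even.neg_one_pow ⟨_, rfl⟩, one_smul]
    refine congrArg (a z.1) ?_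
    rw [Fin.insertNth_eq_iff]
    refine ⟨by simp, ?_⟩
    funext j
    simp [Fin.removeNth]
  rw [ContinuousAlternatingMap.alternatizeUncurryFin_apply]
  simp only [coe_comp, Function.comp_apply, add_apply, flip_apply, hP, hC,
    ContinuousAlternatingMap.add_apply, smul_add, Finset.sum_add_distrib, coe_snd', coe_fst', hi,
    ContinuousAlternatingMap.sub_apply, insertSum_apply, ContinuousAlternatingMap.curryLeft_apply_apply,
    ContinuousAlternatingMap.compContinuousLinearMap_apply]
  have e : (Prod.fst ∘ w) = fun i => (w i).1 := rfl
  rw [e, hd]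
  ring

end LinearAlgebra

/-! ### Chart expressions of the pull-back and of the tautological contraction. -/

section Charts

variable {E : Type*} [NormedAddCommGroup E] [NormedSpace ℝ E]
  {H : Type*} [TopologicalSpace H]
  {I : ModelWithCorners ℝ E H} {M : Type*} [TopologicalSpace M] [ChartedSpace H M]

section
variable [IsManifold I 1 M]

variable (I) in
/-- The contraction of a `(p + 1)`-form on `M` with the tautological vector field: the `p`-form
`(w₁, …, wₚ) ↦ α(u, dπ w₁, …, dπ wₚ)` at `u ∈ TM`. -/
def rawTautContraction {p : ℕ} (α : RawForm I M (p + 1)) :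
    RawForm I.tangent (TangentBundle I M) p := fun u =>
  (ContinuousAlternatingMap.curryLeft (E := E) (α u.proj) u.2).compContinuousLinearMap
    (projDeriv I u)

end

/-- Two forms agree at `x` if they agree in the chart at `x`. -/
theorem RawForm.eq_of_chartRep_eq [IsManifold I 1 M] {p : ℕ} {α β : RawForm I M p} {x : M}
    (h : chartRep I α x (extChartAt I x x) = chartRep I β x (extChartAt I x x)) : α x = β x := by
  have h2 := mfderivWithin_extChartAt_symm_comp_mfderiv_extChartAt' (I := I)
    (mem_extChartAt_source (I := I) x)
  have e : (extChartAt I x).symm (extChartAt I x x) = x := extChartAt_to_inv x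
  -- All tangent spaces unfold to the model space, so a form can be compared at equal base points on
  -- the same `w` without a cast.
  have key : ∀ (γ : RawForm I M p) (r r' : M) (_ : r = r') (w : Fin p → E), γ r w = γ r' w := by
    rintro γ r _ rfl w; rfl
  have hw : ∀ (γ : RawForm I M p) (w : Fin p → E), γ x w =
      chartRep I γ x (extChartAt I x x)
        (fun i => (mfderiv I 𝓘(ℝ, E) (extChartAt I x) x : E →L[ℝ] E) (w i)) := by
    intro γ w
    refine (key γ _ _ e.symm w).trans (congrArg (γ _) (funext fun i => ?_))
    exact (congrArg (fun L : E →L[ℝ] E => L (w i)) h2).symm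
  refine ContinuousAlternatingMap.ext fun w => ?_
  exact (hw α w).trans ((congrArg (fun f : E [⋀^Fin p]→L[ℝ] ℝ => f fun i =>
    (mfderiv I 𝓘(ℝ, E) (extChartAt I x) x : E →L[ℝ] E) (w i)) h).trans (hw β w).symm)

theorem RawForm.ext_chartRep [IsManifold I 1 M] {p : ℕ} {α β : RawForm I M p}
    (h : ∀ x, ∀ y ∈ (extChartAt I x).target, chartRep I α x y = chartRep I β x y) : α = β :=
  funext fun x => RawForm.eq_of_chartRep_eq (h x _ (mem_extChartAt_target x))

variable [IsManifold I ∞ M]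

/-- In the charts of `TM` and `M` the derivative of the projection is `fst`. -/
theorem projDeriv_chart (u : TangentBundle I M) {y : E × E}
    (hy : y ∈ (extChartAt I.tangent u).target) (w : E × E) :
    (projDeriv I ((extChartAt I.tangent u).symm y) : E × E →L[ℝ] E)
      ((mfderivWithin 𝓘(ℝ, E × E) I.tangent (extChartAt I.tangent u).symm (range I.tangent) y :
        E × E →L[ℝ] E × E) w) =
    (mfderivWithin 𝓘(ℝ, E) I (extChartAt I u.proj).symm (range I) y.1 : E →L[ℝ] E) w.1 := by
  have hyr : y ∈ range I.tangent := extChartAt_target_subset_range u hy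
  have U : UniqueMDiffWithinAt 𝓘(ℝ, E × E) (range I.tangent) y := I.tangent.uniqueMDiffOn y hyr
  have hπ : MDifferentiableAt I.tangent I (fun w : TangentBundle I M => w.proj)
      ((extChartAt I.tangent u).symm y) :=
    ((Bundle.contMDiff_proj (n := ∞) (TangentSpace I : M → Type _)).mdifferentiable
      (by simp)) _
  have h1 := mfderiv_comp_mfderivWithin y hπ (mdifferentiableWithinAt_extChartAt_symm hy) U
  have h2 := mfderivWithin_comp (I := 𝓘(ℝ, E × E)) (I' := 𝓘(ℝ, E)) (I'' := I)
    (f := Prod.fst) (s := range I.tangent) (u := range I) y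
    (mdifferentiableWithinAt_extChartAt_symm (I := I) (target_of_tangent I u hy))
    (ContinuousLinearMap.fst ℝ E E).mdifferentiableWithinAt
    (by rintro _ ⟨z, rfl⟩; exact ⟨z.1, rfl⟩) U
  have h3 := (ContinuousLinearMap.fst ℝ E E).mfderivWithin_eq U
  let A : E →L[ℝ] E := mfderivWithin 𝓘(ℝ, E) I (extChartAt I u.proj).symm (range I) y.1
  have h4 : (mfderivWithin 𝓘(ℝ, E × E) I
      ((fun w : TangentBundle I M => w.proj) ∘ (extChartAt I.tangent u).symm) (range I.tangent) y :
        E × E →L[ℝ] E) = A.comp (ContinuousLinearMap.fst ℝ E E) :=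
    h2.trans (congrArg A.comp h3)
  exact congrArg (fun L : E × E →L[ℝ] E => L w) (h1.symm.trans h4)

theorem chartRep_rawPullback {p : ℕ} (α : RawForm I M p) (u : TangentBundle I M) {y : E × E}
    (hy : y ∈ (extChartAt I.tangent u).target) :
    chartRep I.tangent (rawPullback I α) u y =
      (chartRep I α u.proj y.1).compContinuousLinearMap (ContinuousLinearMap.fst ℝ E E) := by
  ext w
  have key : ∀ (q q' : TangentBundle I M) (_ : q = q') (w : Fin p → E),
      α q.proj w = α q'.proj w := by rintro q _ rfl w; rfl
  exact (congrArg (α _) (funext fun i => projDeriv_chart u hy (w i))).trans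
    (key _ _ (extChartAt_tangent_symm I u (target_of_tangent I u hy)) _)

theorem chartRep_rawTautContraction {p : ℕ} (α : RawForm I M (p + 1)) (u : TangentBundle I M)
    {y : E × E} (hy : y ∈ (extChartAt I.tangent u).target) :
    chartRep I.tangent (rawTautContraction I α) u y =
      ((chartRep I α u.proj y.1).curryLeft y.2).compContinuousLinearMap
        (ContinuousLinearMap.fst ℝ E E) := by
  ext w
  have key : ∀ (q q' : TangentBundle I M) (_ : q = q') (w : Fin p → E),
      (α q.proj (Matrix.vecCons (α := E) q.2 w) : ℝ) =
        α q'.proj (Matrix.vecCons (α := E) q'.2 w) := by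
    rintro q _ rfl w; rfl
  let A : E →L[ℝ] E := mfderivWithin 𝓘(ℝ, E) I (extChartAt I u.proj).symm (range I) y.1
  let r : M := (extChartAt I u.proj).symm y.1
  -- The inverse chart of `TM` sends `y` to the vector `A y.2` at `r`, so the tautological argument
  -- is transformed by the same `A` as the projected ones.
  have h1 : (chartRep I.tangent (rawTautContraction I α) u y w : ℝ) =
      α r (Matrix.vecCons (α := E) (A y.2) fun i => A (w i).1) :=
    (congrArg (fun v : Fin p → E => (α _ (Matrix.vecCons (α := E) _ v) : ℝ))
      (funext fun i => projDeriv_chart u hy (w i))).trans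
    (key _ _ (extChartAt_tangent_symm I u (target_of_tangent I u hy)) _)
  have h2 : (fun i => A ((Matrix.vecCons (α := E) y.2 fun i => (w i).1) i)) =
      Matrix.vecCons (α := E) (A y.2) fun i => A (w i).1 := by
    funext i
    refine Fin.cases ?_ (fun j => ?_) i <;> rfl
  exact h1.trans (congrArg (α r) h2).symm

theorem range_tangent_fst {y : E × E} (hy : y ∈ range I.tangent) : y.1 ∈ range I := by
  obtain ⟨z, rfl⟩ := hy
  exact ⟨z.1, rfl⟩

theorem rawPullback_mem {p : ℕ} {α : RawForm I M p} (hα : α ∈ SmoothForm I M p) :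
    rawPullback I α ∈ SmoothForm I.tangent (TangentBundle I M) p := by
  intro u
  refine ContDiffOn.congr ?_ fun y hy => chartRep_rawPullback α u hy
  exact (ContinuousAlternatingMap.compContinuousLinearMapCLM (F := ℝ)
    (ContinuousLinearMap.fst ℝ E E)).contDiff.comp_contDiffOn
      ((hα u.proj).comp contDiff_fst.contDiffOn fun y hy => target_of_tangent I u hy)

theorem rawTautContraction_mem {p : ℕ} {α : RawForm I M (p + 1)}
    (hα : α ∈ SmoothForm I M (p + 1)) :
    rawTautContraction I α ∈ SmoothForm I.tangent (TangentBundle I M) p := by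
  intro u
  refine ContDiffOn.congr ?_ fun y hy => chartRep_rawTautContraction α u hy
  have h0 := (hα u.proj).comp contDiff_fst.contDiffOn fun y hy => target_of_tangent I u hy
  let C := ContinuousAlternatingMap.curryLeftLI (𝕜 := ℝ) (E := E) (F := ℝ) (n := p)
  have h1 := ContDiff.comp_contDiffOn (F := E [⋀^Fin (p + 1)]→L[ℝ] ℝ)
    (G := E →L[ℝ] E [⋀^Fin p]→L[ℝ] ℝ) (g := C)
    (LinearIsometry.contDiff (𝕜 := ℝ) (E := E [⋀^Fin (p + 1)]→L[ℝ] ℝ)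
      (F := E →L[ℝ] E [⋀^Fin p]→L[ℝ] ℝ) C) h0
  exact (ContinuousAlternatingMap.compContinuousLinearMapCLM (F := ℝ)
    (ContinuousLinearMap.fst ℝ E E)).contDiff.comp_contDiffOn
      (h1.clm_apply contDiff_snd.contDiffOn)

end Charts

/-! ### The operators on smooth forms and their relations with `d`, `i_B` and `D`. -/

section Operators

variable {E : Type*} [NormedAddCommGroup E] [NormedSpace ℝ E]
  {H : Type*} [TopologicalSpace H]
  {I : ModelWithCorners ℝ E H} {M : Type*} [TopologicalSpace M] [ChartedSpace H M]
  [IsManifold I ∞ M]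

theorem extDer_extDer {p : ℕ} (α : SmoothForm I M p) :
    extDer I M (p + 1) (extDer I M p α) = 0 := by
  refine Subtype.ext (RawForm.ext_chartRep fun x y hy => ?_)
  have hyr := extChartAt_target_subset_range x hy
  have h : chartRep I (rawExtDeriv I α.1) x =ᶠ[𝓝[range I] y]
      extDerivWithin (chartRep I α.1 x) (range I) := by
    filter_upwards [extChartAt_target_mem_nhdsWithin_of_mem hy] with z hz
    exact chartRep_rawExtDeriv α.2 x hz
  refine (chartRep_rawExtDeriv (rawExtDeriv_mem α.2) x hy).trans ?_
  rw [h.extDerivWithin_eq_of_mem hyr]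
  exact extDerivWithin_extDerivWithin_apply (r := ∞)
    ((α.2 x y hy).mono_of_mem_nhdsWithin (extChartAt_target_mem_nhdsWithin_of_mem hy))
    (by rw [minSmoothness_of_isRCLikeNormedField]; exact ENat.LEInfty.out) I.uniqueDiffOn
    (I.range_subset_closure_interior hyr) hyr

/-- The chart representations of a closed form are closed. -/
theorem extDerivWithin_chartRep_eq_zero {p : ℕ} {α : SmoothForm I M p} (hα : extDer I M p α = 0)
    (x : M) {y : E} (hy : y ∈ (extChartAt I x).target) :
    extDerivWithin (chartRep I α.1 x) (range I) y = 0 := by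
  have h : rawExtDeriv I α.1 = 0 := congrArg Subtype.val hα
  rw [← chartRep_rawExtDeriv α.2 x hy, h]
  rfl

variable (I M) in
/-- The pull-back `π^* : Ω^p(M) → Ω^p(TM)`. -/
def pullbackForm (p : ℕ) :
    SmoothForm I M p →ₗ[ℝ] SmoothForm I.tangent (TangentBundle I M) p where
  toFun α := ⟨rawPullback I α.1, rawPullback_mem α.2⟩
  map_add' _ _ := rfl
  map_smul' _ _ := rfl

/-- The contraction `Ω^{p+1}(M) → Ω^p(TM)` with the tautological vector field. -/
def tautContraction {p : ℕ} (α : SmoothForm I M (p + 1)) :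
    SmoothForm I.tangent (TangentBundle I M) p :=
  ⟨rawTautContraction I α.1, rawTautContraction_mem α.2⟩

theorem extDer_pullbackForm {p : ℕ} (α : SmoothForm I M p) :
    extDer I.tangent (TangentBundle I M) p (pullbackForm I M p α) =
      pullbackForm I M (p + 1) (extDer I M p α) := by
  refine Subtype.ext (RawForm.ext_chartRep fun u y hy => ?_)
  have hyr := extChartAt_target_subset_range u hy
  have hy1 := target_of_tangent I u hy
  have hfst : ∀ z ∈ range I.tangent, fderivWithin ℝ (Prod.fst : E × E → E) (range I.tangent) z =
      ContinuousLinearMap.fst ℝ E E := fun z hz => fderivWithin_fst (I.tangent.uniqueDiffOn z hz)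
  -- The constant map `fst` is written as the derivative of `Prod.fst`, so that naturality of `d`
  -- under pull-back applies.
  have h : chartRep I.tangent (rawPullback I α.1) u =ᶠ[𝓝[range I.tangent] y] fun z =>
      (chartRep I α.1 u.proj (Prod.fst z)).compContinuousLinearMap
        (fderivWithin ℝ (Prod.fst : E × E → E) (range I.tangent) z) := by
    filter_upwards [extChartAt_target_mem_nhdsWithin_of_mem hy, self_mem_nhdsWithin] with z hz hzr
    rw [hfst z hzr]
    exact chartRep_rawPullback α.1 u hz
  refine (chartRep_rawExtDeriv (rawPullback_mem α.2) u hy).trans ?_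
  refine Eq.trans ?_ (chartRep_rawPullback (rawExtDeriv I α.1) u hy).symm
  rw [h.extDerivWithin_eq_of_mem hyr, chartRep_rawExtDeriv α.2 u.proj hy1,
    extDerivWithin_pullback (r := ∞) (t := range I) _ contDiff_fst.contDiffWithinAt
      (by rw [minSmoothness_of_isRCLikeNormedField]; exact ENat.LEInfty.out)
      I.tangent.uniqueDiffOn (I.tangent.range_subset_closure_interior hyr) hyr
      (fun z hz => range_tangent_fst hz), hfst y hyr]
  exact ((α.2 u.proj _ hy1).differentiableWithinAt (by simp)).mono_of_mem_nhdsWithin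
    (extChartAt_target_mem_nhdsWithin_of_mem hy1)

theorem mirrorInsert_pullbackForm {p : ℕ} (α : SmoothForm I M p) :
    mirrorInsert I M p (pullbackForm I M p α) = 0 := by
  refine Subtype.ext (RawForm.ext_chartRep fun u y hy => ?_)
  refine (chartRep_rawInsert_mirrorMap I (rawPullback I α.1) u hy).trans ?_
  rw [chartRep_rawPullback α.1 u hy]
  exact insertSum_inr_fst_compContinuousLinearMap _

theorem mirrorInsert_tautContraction {p : ℕ} (α : SmoothForm I M (p + 1)) :
    mirrorInsert I M p (tautContraction α) = 0 := by
  refine Subtype.ext (RawForm.ext_chartRep fun u y hy => ?_)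
  refine (chartRep_rawInsert_mirrorMap I (rawTautContraction I α.1) u hy).trans ?_
  rw [chartRep_rawTautContraction α.1 u hy]
  exact insertSum_inr_fst_compContinuousLinearMap _

/-- In a chart, the exterior derivative of the contraction of a closed form with the tautological
vector field is the complete lift. -/
theorem extDerivWithin_chartRep_rawTautContraction {p : ℕ} {α : SmoothForm I M (p + 1)}
    (hα : extDer I M (p + 1) α = 0) (u : TangentBundle I M) {y : E × E}
    (hy : y ∈ (extChartAt I.tangent u).target) :
    extDerivWithin (chartRep I.tangent (rawTautContraction I α.1) u) (range I.tangent) y =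
      (fderivWithin ℝ (chartRep I α.1 u.proj) (range I) y.1 y.2).compContinuousLinearMap
          (ContinuousLinearMap.fst ℝ E E)
        + insertSum (ContinuousLinearMap.fst ℝ E E) (ContinuousLinearMap.snd ℝ E E)
          (chartRep I α.1 u.proj y.1) := by
  have hyr := extChartAt_target_subset_range u hy
  have hy1 := target_of_tangent I u hy
  have h : chartRep I.tangent (rawTautContraction I α.1) u =ᶠ[𝓝[range I.tangent] y] fun z =>
      ((chartRep I α.1 u.proj z.1).curryLeft z.2).compContinuousLinearMap
        (ContinuousLinearMap.fst ℝ E E) := by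
    filter_upwards [extChartAt_target_mem_nhdsWithin_of_mem hy] with z hz
    exact chartRep_rawTautContraction α.1 u hz
  rw [h.extDerivWithin_eq_of_mem hyr, extDerivWithin_curryLeft_snd (s := range I) _
    (I.tangent.uniqueDiffOn y hyr) (fun z hz => range_tangent_fst hz),
    extDerivWithin_chartRep_eq_zero hα u.proj hy1]
  · exact sub_zero _
  · exact ((α.2 u.proj _ hy1).differentiableWithinAt (by simp)).mono_of_mem_nhdsWithin
      (extChartAt_target_mem_nhdsWithin_of_mem hy1)

/-- The complete lift of a closed form is the exterior derivative of its contraction with the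
tautological vector field. -/
theorem extDer_tautContraction_val {p : ℕ} {α : SmoothForm I M (p + 1)}
    (hα : extDer I M (p + 1) α = 0) :
    (extDer I.tangent (TangentBundle I M) p (tautContraction α)).1 = rawCompleteLift I α.1 :=
  -- At `u` both sides are defined through the chart at `u`, so only the centre of that chart
  -- matters. Smoothness of the complete lift of a closed form then comes from that of the left
  -- side.
  funext fun u => congrArg (fun f : (E × E) [⋀^Fin (p + 1)]→L[ℝ] ℝ => f.compContinuousLinearMap
      (mfderiv I.tangent 𝓘(ℝ, E × E) (extChartAt I.tangent u) u))
    (extDerivWithin_chartRep_rawTautContraction hα u (mem_extChartAt_target u))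

/-- The complete lift of a locally constant function vanishes. -/
theorem rawCompleteLift_eq_zero {α : SmoothForm I M 0} (hα : extDer I M 0 α = 0) :
    rawCompleteLift I α.1 = 0 := by
  funext u
  let z : E × E := extChartAt I.tangent u u
  have hz : z.1 ∈ (extChartAt I u.proj).target :=
    target_of_tangent I u (mem_extChartAt_target u)
  have h1 : fderivWithin ℝ (chartRep I α.1 u.proj) (range I) z.1 z.2 = 0 := by
    ext w
    -- For a function the alternation has a single summand, so evaluating its zero differential on
    -- `z.2` gives the directional derivative.
    have h := congrArg (fun f => f fun _ => z.2) (extDerivWithin_chartRep_eq_zero hα u.proj hz)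
    simp only [extDerivWithin, ContinuousAlternatingMap.alternatizeUncurryFin_apply,
      Fin.sum_univ_succ] at h
    simpa [Subsingleton.elim w (Fin.removeNth 0 fun _ => z.2)] using h
  have h2 : (fderivWithin ℝ (chartRep I α.1 u.proj) (range I) z.1 z.2).compContinuousLinearMap
        (ContinuousLinearMap.fst ℝ E E)
      + insertSum (ContinuousLinearMap.fst ℝ E E) (ContinuousLinearMap.snd ℝ E E)
        (chartRep I α.1 u.proj z.1) = 0 := by
    ext w
    simp [h1, insertSum_apply]
  exact congrArg (fun f : (E × E) [⋀^Fin 0]→L[ℝ] ℝ => f.compContinuousLinearMap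
      (mfderiv I.tangent 𝓘(ℝ, E × E) (extChartAt I.tangent u) u)) h2

/-- In a chart the derivative of the contraction has a horizontal summand, killed by `i_B`, and a
summand with one `dv` in each of the `p + 1` slots, each of which yields one copy of the pull-back.
-/
theorem mirrorInsert_extDer_tautContraction {p : ℕ} {α : SmoothForm I M (p + 1)}
    (hα : extDer I M (p + 1) α = 0) :
    mirrorInsert I M (p + 1) (extDer I.tangent (TangentBundle I M) p (tautContraction α)) =
      ((p + 1 : ℕ) : ℝ) • pullbackForm I M (p + 1) α := by
  refine Subtype.ext (RawForm.ext_chartRep fun u y hy => ?_)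
  refine (chartRep_rawInsert_mirrorMap I _ u hy).trans ?_
  have h1 : chartRep I.tangent
      (extDer I.tangent (TangentBundle I M) p (tautContraction α)).1 u y = _ :=
    (chartRep_rawExtDeriv (rawTautContraction_mem α.2) u hy).trans
      (extDerivWithin_chartRep_rawTautContraction hα u hy)
  rw [h1, map_add, insertSum_inr_fst_compContinuousLinearMap, zero_add,
    insertSum_inr_fst_insertSum_fst_snd, ← chartRep_rawPullback α.1 u hy]
  rfl

/-! ### Values of `D` on the pull-back, the contraction and the complete lift. -/

theorem mirrorD_apply (c : ℝ) {p : ℕ} (η : SmoothForm I.tangent (TangentBundle I M) p) :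
    mirrorD I M c p η = c • extDer I.tangent (TangentBundle I M) p η +
      (mirrorInsert I M (p + 1) (extDer I.tangent (TangentBundle I M) p η) -
        extDer I.tangent (TangentBundle I M) p (mirrorInsert I M p η)) :=
  rfl

theorem mirrorD_pullbackForm (c : ℝ) {p : ℕ} (α : SmoothForm I M p) :
    mirrorD I M c p (pullbackForm I M p α) = c • pullbackForm I M (p + 1) (extDer I M p α) := by
  rw [mirrorD_apply, extDer_pullbackForm, mirrorInsert_pullbackForm, mirrorInsert_pullbackForm,
    map_zero, sub_zero, add_zero]

/-- The key relation: a `D`-exact combination of the complete lift and the pull-back. The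
contraction is horizontal, so only `i_B ∘ d` contributes to `d_B`. -/
theorem mirrorD_tautContraction (c : ℝ) {p : ℕ} {α : SmoothForm I M (p + 1)}
    (hα : extDer I M (p + 1) α = 0) :
    mirrorD I M c p (tautContraction α) =
      c • extDer I.tangent (TangentBundle I M) p (tautContraction α) +
        ((p + 1 : ℕ) : ℝ) • pullbackForm I M (p + 1) α := by
  rw [mirrorD_apply, mirrorInsert_extDer_tautContraction hα, mirrorInsert_tautContraction,
    map_zero, sub_zero]

/-- Since `d² = 0`, only `-d ∘ i_B` survives; it gives a multiple of `d π^*α = π^* dα = 0`. -/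
theorem mirrorD_extDer_tautContraction (c : ℝ) {p : ℕ} {α : SmoothForm I M (p + 1)}
    (hα : extDer I M (p + 1) α = 0) :
    mirrorD I M c (p + 1) (extDer I.tangent (TangentBundle I M) p (tautContraction α)) = 0 := by
  rw [mirrorD_apply, extDer_extDer, mirrorInsert_extDer_tautContraction hα, map_smul,
    extDer_pullbackForm, hα]
  simp only [map_zero, smul_zero, sub_zero, add_zero]

/-! ### Passage to cohomology. -/

variable (I M) in
/-- The pull-back on cocycles. -/
def pullbackCocycle (c : ℝ) (p : ℕ) :
    LinearMap.ker (extDer I M p) →ₗ[ℝ] LinearMap.ker (mirrorD I M c p) :=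
  (pullbackForm I M p).restrict fun α hα => by
    rw [LinearMap.mem_ker] at hα ⊢
    rw [mirrorD_pullbackForm, hα, map_zero, smul_zero]

theorem pullbackForm_mem_boundaries {c : ℝ} (hc : c ≠ 0) {p : ℕ} {α : SmoothForm I M p}
    (hα : α ∈ boundaries (extDer I M) p) :
    pullbackForm I M p α ∈ boundaries (mirrorD I M c) p := by
  cases p with
  | zero =>
    rw [(Submodule.mem_bot ℝ).1 hα, map_zero]
    exact zero_mem _
  | succ p =>
    obtain ⟨τ, rfl⟩ := hα
    -- On pull-backs `D` is `c d`, so the primitive has to be divided by `c`.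
    refine ⟨c⁻¹ • pullbackForm I M p τ, ?_⟩
    rw [map_smul, mirrorD_pullbackForm, inv_smul_smul₀ hc]

variable (I M) in
/-- The pull-back `H^p(M) → H^p_D(TM)`. -/
def pullbackCohomology {c : ℝ} (hc : c ≠ 0) (p : ℕ) :
    Cohomology (extDer I M) p →ₗ[ℝ] Cohomology (mirrorD I M c) p :=
  Submodule.mapQ _ _ (pullbackCocycle I M c p) fun _ hα => pullbackForm_mem_boundaries hc hα

/-- In `H^p_D(TM)` the class of the complete lift of a closed `p`-form is `-p / c` times the class
of its pull-back. -/
theorem exists_completeLift_cocycle {c : ℝ} (hc : c ≠ 0) (p : ℕ)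
    (α : LinearMap.ker (extDer I M p)) :
    ∃ η : LinearMap.ker (mirrorD I M c p), η.1.1 = rawCompleteLift I α.1.1 ∧
      (-(p / c : ℝ)) • cohomologyClass (mirrorD I M c) p (pullbackCocycle I M c p α) =
        cohomologyClass (mirrorD I M c) p η := by
  obtain ⟨α, hα⟩ := α
  rw [LinearMap.mem_ker] at hα
  cases p with
  | zero =>
    -- A closed function has zero complete lift, matching the factor `-(0 / c)`.
    refine ⟨0, (rawCompleteLift_eq_zero hα).symm, ?_⟩
    simp
  | succ p =>
    refine ⟨⟨_, LinearMap.mem_ker.2 (mirrorD_extDer_tautContraction c hα)⟩, extDer_tautContraction_val hα, ?_⟩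
    -- Dividing the formula for `D` of the contraction by `c` exhibits the difference of the two
    -- cocycles as a boundary.
    have h : mirrorD I M c p (c⁻¹ • tautContraction α) =
        extDer I.tangent (TangentBundle I M) p (tautContraction α) -
          (-((p + 1 : ℕ) / c : ℝ)) • pullbackForm I M (p + 1) α := by
      rw [map_smul, mirrorD_tautContraction c hα, smul_add, inv_smul_smul₀ hc, smul_smul,
        inv_mul_eq_div, neg_smul, sub_neg_eq_add]
    rw [← map_smul, eq_comm]
    exact (Submodule.Quotient.eq _).2 ⟨c⁻¹ • tautContraction α, h⟩

end Operators

end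

theorem mainTheorem3 (m : ℕ) (M : Type*) [TopologicalSpace M] [T2Space M]
    [SecondCountableTopology M] [ChartedSpace (EuclideanSpace ℝ (Fin m)) M]
    [IsManifold (𝓡 m) ∞ M] (c : ℝ) (hc : c ≠ 0) :
    ∃ lift pull : ∀ p : ℕ,
        Cohomology (extDer (𝓡 m) M) p →ₗ[ℝ] Cohomology (mirrorD (𝓡 m) M c) p,
      (∀ (p : ℕ) (α : LinearMap.ker (extDer (𝓡 m) M p)),
        ∃ η : LinearMap.ker (mirrorD (𝓡 m) M c p),
          η.1.1 = rawCompleteLift (𝓡 m) α.1.1 ∧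
          lift p (cohomologyClass (extDer (𝓡 m) M) p α) =
            cohomologyClass (mirrorD (𝓡 m) M c) p η) ∧
      (∀ (p : ℕ) (α : LinearMap.ker (extDer (𝓡 m) M p)),
        ∃ η : LinearMap.ker (mirrorD (𝓡 m) M c p),
          η.1.1 = rawPullback (𝓡 m) α.1.1 ∧
          pull p (cohomologyClass (extDer (𝓡 m) M) p α) =
            cohomologyClass (mirrorD (𝓡 m) M c) p η) ∧
      ∀ p : ℕ, 1 ≤ p → ∀ a : Cohomology (extDer (𝓡 m) M) p, lift p a = 0 ↔ pull p a = 0 := by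
  -- Choosing the lift as this multiple of the pull-back makes it linear and independent of
  -- representatives; the cocycle lemma identifies it with the class of the complete lift.
  refine ⟨fun p => (-(p / c : ℝ)) • pullbackCohomology (𝓡 m) M hc p,
    fun p => pullbackCohomology (𝓡 m) M hc p, ?_, ?_, ?_⟩
  · intro p α
    exact exists_completeLift_cocycle hc p α
  · intro p α
    exact ⟨pullbackCocycle (𝓡 m) M c p α, rfl, rfl⟩
  · intro p hp a
    -- Here `1 ≤ p` is essential: in degree `0` the factor vanishes.
    have h : -(p / c : ℝ) ≠ 0 := neg_ne_zero.2 (div_ne_zero (by positivity) hc)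
    exact LinearMap.smul_apply_eq_zero_iff h _ a
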